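/- For a finite set $C\subset\mathbb Z^d$ let $\Theta_d(C)=\{(x,y)\in\mathbb Z^d\times\mathbb Z^d : |x-y|=1,\ x\in C,\ y\notin C\}$ be its edge boundary, where $|\cdot|$ is the Euclidean norm. For $n\in\mathbb N$ let $EIP^d(n)=\min\{\#\Theta_d(C) : C\subset\mathbb Z^d,\ \#C=n\}$. A nonempty finite set $C\subset\mathbb Z^d$ is called an $EIP^d$ minimizer if $\#\Theta_d(C)=EIP^d(\#C)$; by convention the empty set is also an $EIP^d$ minimizer. Let $d\ge 2$ and $j\in\{0,\dots,d-1\}$ be integers, and let $\ell,p\in\mathbb N$ satisfy $2p<\ell$ and $$2p\ \ge\ 4^{\,c_d}\,h_{\ell,d},\qquad\text{where } c_d=1-2^{1-d}\ \text{ and }\ h_{\ell,d}=\ell^{\,2^{1-d}}.$$ Then the box $$\{1,\dots,\ell-2p\}\times\{1,\dots,\ell+1\}^{j}\times\{1,\dots,\ell\}^{d-1-j}\subset\mathbb Z^d$$ is not an $EIP^d$ minimizer. -/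

import Mathlib

namespace EIP

/-- The edge boundary `Θ_d(C)`: ordered pairs `(x, y)` of points of `ℤ^d` at Euclidean distance `1`
with `x ∈ C` and `y ∉ C`. For integer points, `|x - y| = 1` is `∑ i, (x i - y i) ^ 2 = 1`. -/
def edgeBoundary {d : ℕ} (C : Finset (Fin d → ℤ)) : Set ((Fin d → ℤ) × (Fin d → ℤ)) :=
  {z | ∑ i, (z.1 i - z.2 i) ^ 2 = 1 ∧ z.1 ∈ C ∧ z.2 ∉ C}

/-- The edge perimeter `#Θ_d(C)`. The edge boundary of a finite set is finite, so `ncard` is its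
true cardinality. -/
noncomputable def edgePerimeter {d : ℕ} (C : Finset (Fin d → ℤ)) : ℕ :=
  (edgeBoundary C).ncard

/-- `EIP^d(n)`: the minimum of the edge perimeter over all sets of `n` points of `ℤ^d`. -/
noncomputable def minPerimeter (d n : ℕ) : ℕ :=
  sInf {m | ∃ C : Finset (Fin d → ℤ), C.card = n ∧ edgePerimeter C = m}

/-- `C` is an `EIP^d` minimizer. The empty set is one by convention. -/
def IsMinimizer {d : ℕ} (C : Finset (Fin d → ℤ)) : Prop :=
  C = ∅ ∨ edgePerimeter C = minPerimeter d C.card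

/-- The box `{1, …, ℓ - q} × {1, …, ℓ + 1}^j × {1, …, ℓ}^(d - 1 - j)` in `ℤ^d` (with `j ≤ d - 1`);
the coordinates are numbered from `0`. -/
noncomputable def box (ℓ j d q : ℕ) : Finset (Fin d → ℤ) :=
  Fintype.piFinset fun i : Fin d =>
    if i.val = 0 then Finset.Icc 1 ((ℓ : ℤ) - (q : ℤ))
    else if i.val ≤ j then Finset.Icc 1 ((ℓ : ℤ) + 1)
    else Finset.Icc 1 (ℓ : ℤ)

/-- The scaling parameter `h_{ℓ,d} = ℓ ^ (2 ^ (1 - d))`. -/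
noncomputable def scale (ℓ d : ℕ) : ℝ :=
  (ℓ : ℝ) ^ ((2 : ℝ) ^ (1 - (d : ℝ)))

/-- The exponent `c_d = 1 - 2 ^ (1 - d)`. -/
noncomputable def cexp (d : ℕ) : ℝ :=
  1 - (2 : ℝ) ^ (1 - (d : ℝ))

end EIP

namespace EIP

/-! Let `R` and `P` be the volume and perimeter of `grid m`. The box with sides `a, b, m` has
perimeter `2(a+b)R + abP`, so at fixed `a + b` balancing the first two sides into `u, v` gains
volume without changing the first term. The excess volume is then removed from the top layers. If it
fills a whole layer `v × m`, the term in `R` drops strictly (`exists_better_of_mul_le`). Otherwise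
the top layer becomes a box `c × m` and the perimeter is unchanged; but this layer is a box of the
same kind in one dimension less, with shortage `ℓ - c` at least `(ℓ - a)²/4`. Improving it by
induction improves the whole set (`exists_better_of_top_layer`, `exists_better_grid`). The
hypothesis on `p` makes the shortage large enough to end, in dimension two at the latest, with a
full layer removed. -/

/-- The points of `C` whose neighbour in direction `i`, with step `ε`, lies outside `C`. -/
def outward {d : ℕ} (C : Finset (Fin d → ℤ)) (i : Fin d) (ε : ℤ) : Finset (Fin d → ℤ) :=
  C.filter fun x => Function.update x i (x i + ε) ∉ C

theorem mem_outward {d : ℕ} {C : Finset (Fin d → ℤ)} {i : Fin d} {ε : ℤ} {x : Fin d → ℤ} :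
    x ∈ outward C i ε ↔ x ∈ C ∧ Function.update x i (x i + ε) ∉ C := by
  simp [outward]

/-- The edge perimeter counted direction by direction. -/
def directionalPerimeter {d : ℕ} (C : Finset (Fin d → ℤ)) : ℕ :=
  ∑ i, ((outward C i 1).card + (outward C i (-1)).card)

theorem sum_sq_sub_update {d : ℕ} (x : Fin d → ℤ) (i : Fin d) (ε : ℤ) :
    ∑ k, (x k - Function.update x i (x i + ε) k) ^ 2 = ε ^ 2 := by
  rw [Finset.sum_eq_single i]
  · simp
  · intro k _ hk
    simp [Function.update_of_ne hk]
  · simp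

theorem exists_update_of_sum_sq_eq_one {d : ℕ} {x y : Fin d → ℤ}
    (h : ∑ k, (x k - y k) ^ 2 = 1) :
    ∃ i ε, (ε = 1 ∨ ε = -1) ∧ y = Function.update x i (x i + ε) := by
  obtain ⟨i, hi⟩ : ∃ i, x i - y i ≠ 0 := by
    by_contra! hc
    simp [hc] at h
  have hsq : 1 ≤ (x i - y i) ^ 2 := by
    have : 0 < (x i - y i) ^ 2 := by positivity
    linarith
  rw [← Finset.add_sum_erase _ _ (Finset.mem_univ i)] at h
  have hnn : ∀ k ∈ Finset.univ.erase i, 0 ≤ (x k - y k) ^ 2 := fun k _ => sq_nonneg _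
  have hs := Finset.sum_nonneg hnn
  have hzero := (Finset.sum_eq_zero_iff_of_nonneg hnn).1 (by linarith)
  have hone : (y i - x i) ^ 2 = 1 := by nlinarith
  refine ⟨i, y i - x i, by simpa using hone, ?_⟩
  funext k
  by_cases hk : k = i
  · subst hk; simp
  · rw [Function.update_of_ne hk]
    have := hzero k (by simp [hk])
    have := pow_eq_zero_iff (two_ne_zero) |>.1 this
    linarith

theorem edgePerimeter_eq {d : ℕ} (C : Finset (Fin d → ℤ)) :
    edgePerimeter C = directionalPerimeter C := by
  classical
  let S : Finset (Σ _ : Fin d × ℤ, Fin d → ℤ) :=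
    ((Finset.univ : Finset (Fin d)) ×ˢ ({1, -1} : Finset ℤ)).sigma
      fun w => outward C w.1 w.2
  let f : (Σ _ : Fin d × ℤ, Fin d → ℤ) → (Fin d → ℤ) × (Fin d → ℤ) :=
    fun w => (w.2, Function.update w.2 w.1.1 (w.2 w.1.1 + w.1.2))
  have himage : edgeBoundary C = f '' (S : Set _) := by
    ext ⟨x, y⟩
    constructor
    · rintro ⟨hxy, hx, hy⟩
      dsimp only at hxy hx hy
      obtain ⟨i, ε, hε, rfl⟩ := exists_update_of_sum_sq_eq_one hxy
      refine ⟨⟨(i, ε), x⟩, ?_, rfl⟩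
      simpa [S, mem_outward] using ⟨hε, hx, hy⟩
    · rintro ⟨⟨⟨i, ε⟩, z⟩, hz, hf⟩
      simp only [f, Prod.mk.injEq] at hf
      obtain ⟨rfl, rfl⟩ := hf
      simp only [S, Finset.coe_sigma, Set.mem_sigma_iff, Finset.mem_coe, Finset.mem_product,
        Finset.mem_univ, true_and, Finset.mem_insert, Finset.mem_singleton, mem_outward] at hz
      refine ⟨?_, hz.2.1, hz.2.2⟩
      simp only [sum_sq_sub_update]
      rcases hz.1 with rfl | rfl <;> norm_num
  have hinj : Set.InjOn f (S : Set _) := by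
    rintro ⟨⟨i, ε⟩, x⟩ hz ⟨⟨i', ε'⟩, x'⟩ hz' hf
    simp only [f, Prod.mk.injEq] at hf
    obtain ⟨rfl, hf⟩ := hf
    simp only [S, Finset.coe_sigma, Set.mem_sigma_iff, Finset.mem_coe, Finset.mem_product,
      Finset.mem_univ, true_and, Finset.mem_insert, Finset.mem_singleton] at hz
    have h0 : ε ≠ 0 := by rcases hz.1 with rfl | rfl <;> norm_num
    have h := congrFun hf i
    by_cases hi : i = i'
    · subst hi
      simp at h
      subst h
      rfl
    · simp [Function.update_of_ne hi, h0] at h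
  rw [edgePerimeter, himage, hinj.ncard_image, Set.ncard_coe_finset,
    Finset.card_sigma, Finset.sum_product, directionalPerimeter]
  refine Finset.sum_congr rfl fun i _ => ?_
  rw [Finset.sum_pair (by norm_num)]

/-! ### Perimeter of stacked layers -/

theorem exists_eq_cons {n : ℕ} {α : Type*} (z : Fin (n + 1) → α) :
    ∃ x y, z = (Fin.cons x y : Fin (n + 1) → α) :=
  ⟨z 0, Fin.tail z, (Fin.cons_self_tail z).symm⟩

/-- `m` copies of `A` stacked along the first coordinate, with a copy of `B` on top. -/
noncomputable def stack {n : ℕ} (m : ℕ) (A B : Finset (Fin n → ℤ)) : Finset (Fin (n + 1) → ℤ) :=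
  (Finset.Icc (1 : ℤ) m ×ˢ A ∪ {(m : ℤ) + 1} ×ˢ B).map
    (Fin.consEquiv fun _ => ℤ).toEmbedding

theorem cons_mem_stack {n m : ℕ} {A B : Finset (Fin n → ℤ)} {x : ℤ} {y : Fin n → ℤ} :
    (Fin.cons x y : Fin (n + 1) → ℤ) ∈ stack m A B ↔
      (1 ≤ x ∧ x ≤ m) ∧ y ∈ A ∨ x = m + 1 ∧ y ∈ B := by
  have : (Fin.cons x y : Fin (n + 1) → ℤ) = (Fin.consEquiv fun _ => ℤ).toEmbedding (x, y) := rfl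
  rw [stack, this, Finset.mem_map']
  simp only [Finset.mem_union, Finset.mem_product, Finset.mem_Icc, Finset.mem_singleton]

theorem card_stack {n : ℕ} (m : ℕ) (A B : Finset (Fin n → ℤ)) :
    (stack m A B).card = m * A.card + B.card := by
  rw [stack, Finset.card_map, Finset.card_union_of_disjoint]
  · simp
  · rw [Finset.disjoint_product]
    left
    simp

theorem outward_stack_succ {n : ℕ} (m : ℕ) (A B : Finset (Fin n → ℤ)) (i : Fin n) (ε : ℤ) :
    outward (stack m A B) i.succ ε = stack m (outward A i ε) (outward B i ε) := by
  ext z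
  obtain ⟨x, y, rfl⟩ := exists_eq_cons z
  rw [mem_outward, Fin.cons_succ, ← Fin.cons_update]
  simp only [cons_mem_stack, mem_outward]
  constructor
  · rintro ⟨h1 | h1, h2⟩
    · left; refine ⟨h1.1, h1.2, fun h => h2 (Or.inl ⟨h1.1, h⟩)⟩
    · right; refine ⟨h1.1, h1.2, fun h => h2 (Or.inr ⟨h1.1, h⟩)⟩
  · rintro (h1 | h1)
    · refine ⟨Or.inl ⟨h1.1, h1.2.1⟩, ?_⟩
      rintro (h | h)
      · exact h1.2.2 h.2
      · linarith [h1.1.2, h.1]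
    · refine ⟨Or.inr ⟨h1.1, h1.2.1⟩, ?_⟩
      rintro (h | h)
      · linarith [h1.1, h.1.2]
      · exact h1.2.2 h.2

theorem directionalPerimeter_stack {n : ℕ} (m : ℕ) (A B : Finset (Fin n → ℤ)) :
    directionalPerimeter (stack m A B) =
      (outward (stack m A B) 0 1).card + (outward (stack m A B) 0 (-1)).card +
        (m * directionalPerimeter A + directionalPerimeter B) := by
  simp only [directionalPerimeter, Fin.sum_univ_succ, outward_stack_succ, card_stack,
    Finset.mul_sum, ← Finset.sum_add_distrib]
  congr 1
  refine Finset.sum_congr rfl fun i _ => ?_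
  ring

theorem cons_mem_outward_zero {n m : ℕ} {A B : Finset (Fin n → ℤ)} {x ε : ℤ} {y : Fin n → ℤ} :
    (Fin.cons x y : Fin (n + 1) → ℤ) ∈ outward (stack m A B) 0 ε ↔
      ((1 ≤ x ∧ x ≤ m) ∧ y ∈ A ∨ x = m + 1 ∧ y ∈ B) ∧
        ¬ ((1 ≤ x + ε ∧ x + ε ≤ m) ∧ y ∈ A ∨ x + ε = m + 1 ∧ y ∈ B) := by
  rw [mem_outward, Fin.cons_zero, Fin.update_cons_zero, cons_mem_stack, cons_mem_stack]

/-- Since `B ⊆ A`, each vertical line meeting the stack lies over a point of `A` and meets it in one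
interval, so it is left once in each direction. -/
theorem card_outward_stack_zero_le {n m : ℕ} {A B : Finset (Fin n → ℤ)} (hBA : B ⊆ A) {ε : ℤ}
    (hε : ε = 1 ∨ ε = -1) : (outward (stack m A B) 0 ε).card ≤ A.card := by
  refine Finset.card_le_card_of_injOn Fin.tail ?_ ?_
  · intro z hz
    obtain ⟨x, y, rfl⟩ := exists_eq_cons z
    rw [Finset.mem_coe, cons_mem_outward_zero] at hz
    rw [Fin.tail_cons]
    rcases hz.1 with h | h
    · exact h.2
    · exact hBA h.2
  · intro z hz z' hz' hzz
    obtain ⟨x, y, rfl⟩ := exists_eq_cons z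
    obtain ⟨x', y', rfl⟩ := exists_eq_cons z'
    rw [Finset.mem_coe, cons_mem_outward_zero] at hz hz'
    rw [Fin.tail_cons, Fin.tail_cons] at hzz
    subst hzz
    have hA : y ∈ A := by
      rcases hz.1 with h | h
      · exact h.2
      · exact hBA h.2
    congr 1
    simp only [hA, and_true] at hz hz'
    by_cases hB : y ∈ B
    · simp only [hB, and_true] at hz hz'
      rcases hε with rfl | rfl <;> omega
    · simp only [hB, and_false, or_false] at hz hz'
      rcases hε with rfl | rfl <;> omega

theorem directionalPerimeter_stack_le {n m : ℕ} {A B : Finset (Fin n → ℤ)} (hBA : B ⊆ A) :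
    directionalPerimeter (stack m A B) ≤
      2 * A.card + m * directionalPerimeter A + directionalPerimeter B := by
  rw [directionalPerimeter_stack]
  have h1 := card_outward_stack_zero_le (m := m) hBA (Or.inl rfl)
  have h2 := card_outward_stack_zero_le (m := m) hBA (Or.inr rfl)
  omega

theorem card_le_card_outward_stack_empty {n m : ℕ} (A : Finset (Fin n → ℤ)) (hm : 1 ≤ m) {ε : ℤ}
    (hε : ε = 1 ∨ ε = -1) : A.card ≤ (outward (stack m A ∅) 0 ε).card := by
  refine Finset.card_le_card_of_injOn
    (fun y => Fin.cons (if ε = 1 then (m : ℤ) else 1) y) ?_ ?_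
  · intro y hy
    rw [Finset.mem_coe] at hy
    rw [Finset.mem_coe, cons_mem_outward_zero]
    rcases hε with rfl | rfl <;> simp [hy] <;> omega
  · intro y _ y' _ h
    exact (Fin.cons_injective2 h).2

theorem directionalPerimeter_empty {n : ℕ} :
    directionalPerimeter (∅ : Finset (Fin n → ℤ)) = 0 := by
  simp [directionalPerimeter, outward]

theorem le_directionalPerimeter_stack_empty {n m : ℕ} (A : Finset (Fin n → ℤ)) (hm : 1 ≤ m) :
    2 * A.card + m * directionalPerimeter A ≤ directionalPerimeter (stack m A ∅) := by
  rw [directionalPerimeter_stack]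
  have h1 := card_le_card_outward_stack_empty A hm (Or.inl rfl)
  have h2 := card_le_card_outward_stack_empty A hm (Or.inr rfl)
  omega

/-! ### Boxes: volume and perimeter -/

/-- The box `∏ i, {1, …, m i}`. -/
noncomputable def grid {n : ℕ} (m : Fin n → ℕ) : Finset (Fin n → ℤ) :=
  Fintype.piFinset fun i => Finset.Icc (1 : ℤ) (m i)

theorem mem_grid {n : ℕ} {m : Fin n → ℕ} {x : Fin n → ℤ} :
    x ∈ grid m ↔ ∀ i, 1 ≤ x i ∧ x i ≤ m i := by
  simp [grid]

theorem cons_mem_grid {n a : ℕ} {m : Fin n → ℕ} {x : ℤ} {y : Fin n → ℤ} :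
    (Fin.cons x y : Fin (n + 1) → ℤ) ∈ grid (Fin.cons a m : Fin (n + 1) → ℕ) ↔
      (1 ≤ x ∧ x ≤ a) ∧ y ∈ grid m := by
  simp [mem_grid, Fin.forall_fin_succ]

theorem grid_cons {n : ℕ} (a : ℕ) (m : Fin n → ℕ) :
    grid (Fin.cons a m : Fin (n + 1) → ℕ) = stack a (grid m) ∅ := by
  ext z
  obtain ⟨x, y, rfl⟩ := exists_eq_cons z
  rw [cons_mem_grid, cons_mem_stack]; simp

theorem grid_cons_mono {n a b : ℕ} (hab : a ≤ b) (m : Fin n → ℕ) :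
    grid (Fin.cons a m : Fin (n + 1) → ℕ) ⊆ grid (Fin.cons b m : Fin (n + 1) → ℕ) := by
  intro z hz
  obtain ⟨x, y, rfl⟩ := exists_eq_cons z
  rw [cons_mem_grid] at hz ⊢
  exact ⟨⟨hz.1.1, hz.1.2.trans (by exact_mod_cast hab)⟩, hz.2⟩

theorem stack_subset_grid {n k u : ℕ} {m : Fin n → ℕ} {A B : Finset (Fin n → ℤ)}
    (hk : k + 1 ≤ u) (hA : A ⊆ grid m) (hBA : B ⊆ A) :
    stack k A B ⊆ grid (Fin.cons u m : Fin (n + 1) → ℕ) := by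
  intro z hz
  obtain ⟨x, y, rfl⟩ := exists_eq_cons z
  rw [cons_mem_stack] at hz
  rw [cons_mem_grid]
  rcases hz with h | h
  · exact ⟨⟨h.1.1, by omega⟩, hA h.2⟩
  · exact ⟨⟨by omega, by omega⟩, hA (hBA h.2)⟩

theorem card_grid_cons {n : ℕ} (a : ℕ) (m : Fin n → ℕ) :
    (grid (Fin.cons a m : Fin (n + 1) → ℕ)).card = a * (grid m).card := by
  simp [grid_cons, card_stack]

theorem card_grid_pos {n : ℕ} {m : Fin n → ℕ} (hm : ∀ i, 1 ≤ m i) : 0 < (grid m).card :=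
  Finset.card_pos.2 ⟨fun _ => 1, mem_grid.2 fun i => ⟨le_rfl, by exact_mod_cast hm i⟩⟩

theorem directionalPerimeter_grid_cons_le {n : ℕ} (a : ℕ) (m : Fin n → ℕ) :
    directionalPerimeter (grid (Fin.cons a m : Fin (n + 1) → ℕ)) ≤
      2 * (grid m).card + a * directionalPerimeter (grid m) := by
  rw [grid_cons]
  have h := directionalPerimeter_stack_le (m := a) (Finset.empty_subset (grid m))
  rwa [directionalPerimeter_empty, add_zero] at h

theorem directionalPerimeter_grid_cons {n a : ℕ} (ha : 1 ≤ a) (m : Fin n → ℕ) :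
    directionalPerimeter (grid (Fin.cons a m : Fin (n + 1) → ℕ)) =
      2 * (grid m).card + a * directionalPerimeter (grid m) := by
  refine le_antisymm (directionalPerimeter_grid_cons_le a m) ?_
  rw [grid_cons]
  exact le_directionalPerimeter_stack_empty _ ha

theorem directionalPerimeter_grid_cons_cons {n a b : ℕ} (ha : 1 ≤ a) (hb : 1 ≤ b)
    (m : Fin n → ℕ) :
    directionalPerimeter (grid (Fin.cons a (Fin.cons b m : Fin (n + 1) → ℕ) : Fin (n + 2) → ℕ)) =
      2 * (a + b) * (grid m).card + a * b * directionalPerimeter (grid m) := by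
  rw [directionalPerimeter_grid_cons ha, directionalPerimeter_grid_cons hb, card_grid_cons]
  ring

/-! ### The two ways to improve a box -/

/-- If `a * b ≤ (u - 1) * v` with `u + v = a + b`, then the box with sides `a, b, m` is improved by
a set of the same volume inside the box with sides `u - 1, v, m`. -/
theorem exists_better_of_mul_le {n a b u v : ℕ} {m : Fin n → ℕ} (hm : ∀ i, 1 ≤ m i)
    (ha : 1 ≤ a) (hb : 1 ≤ b) (hv : 1 ≤ v) (hvb : v ≤ b) (hsum : u + v = a + b)
    (hvol : a * b + v ≤ u * v) :
    ∃ C ⊆ grid (Fin.cons u (Fin.cons b m : Fin (n + 1) → ℕ) : Fin (n + 2) → ℕ),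
      C.card = a * b * (grid m).card ∧
      directionalPerimeter C < directionalPerimeter
        (grid (Fin.cons a (Fin.cons b m : Fin (n + 1) → ℕ) : Fin (n + 2) → ℕ)) := by
  set N := a * b with hN
  set k := N / v with hk
  set r := N % v with hr
  have hdiv : v * k + r = N := Nat.div_add_mod N v
  have hrv : r < v := Nat.mod_lt _ hv
  have hku : k + 1 ≤ u := by
    by_contra! hc
    have : u * v ≤ k * v := Nat.mul_le_mul_right v (by omega)
    nlinarith
  have hsub : grid (Fin.cons r m : Fin (n + 1) → ℕ) ⊆ grid (Fin.cons v m : Fin (n + 1) → ℕ) :=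
    grid_cons_mono hrv.le m
  refine ⟨stack k (grid (Fin.cons v m : Fin (n + 1) → ℕ)) (grid (Fin.cons r m : Fin (n + 1) → ℕ)),
    stack_subset_grid hku (grid_cons_mono hvb m) hsub, ?_, ?_⟩
  · rw [card_stack, card_grid_cons, card_grid_cons, ← hdiv]
    ring
  · rw [directionalPerimeter_grid_cons_cons ha hb, ← hN, ← hsum]
    have h1 := directionalPerimeter_stack_le (m := k) hsub
    rw [card_grid_cons, directionalPerimeter_grid_cons hv] at h1
    refine h1.trans_lt ?_
    have hR := card_grid_pos hm
    generalize hRR : (grid m).card = R at *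
    generalize hP : directionalPerimeter (grid m) = P at *
    -- The stack has height `k` if `r = 0` and `k + 1` otherwise; in both cases this is less than
    -- `u`, which gives strictness.
    rcases Nat.eq_zero_or_pos r with h0 | h0
    · have hempty : grid (Fin.cons r m : Fin (n + 1) → ℕ) = ∅ := by
        rw [← Finset.card_eq_zero, card_grid_cons, h0, zero_mul]
      rw [hempty, directionalPerimeter_empty]
      have : (k + 1) * R ≤ u * R := Nat.mul_le_mul_right R hku
      rw [← hdiv]
      nlinarith
    · rw [directionalPerimeter_grid_cons h0, hP, hRR]
      have hku' : k + 1 + 1 ≤ u := by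
        by_contra! hc
        have : u = k + 1 := by omega
        subst this
        nlinarith
      have : (k + 1 + 1) * R ≤ u * R := Nat.mul_le_mul_right R hku'
      rw [← hdiv]
      nlinarith

/-- Replacing the top layer of a box by a set with smaller perimeter. -/
theorem exists_better_of_top_layer {n a b c u v : ℕ} {m : Fin n → ℕ}
    (ha : 1 ≤ a) (hb : 1 ≤ b) (hu : 1 ≤ u) (hvb : v ≤ b) (hsum : u + v = a + b)
    (hvol : (u - 1) * v + c = a * b) {B : Finset (Fin (n + 1) → ℤ)}
    (hBv : B ⊆ grid (Fin.cons v m : Fin (n + 1) → ℕ)) (hBcard : B.card = c * (grid m).card)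
    (hBper : directionalPerimeter B <
      directionalPerimeter (grid (Fin.cons c m : Fin (n + 1) → ℕ))) :
    ∃ C ⊆ grid (Fin.cons u (Fin.cons b m : Fin (n + 1) → ℕ) : Fin (n + 2) → ℕ),
      C.card = a * b * (grid m).card ∧
      directionalPerimeter C < directionalPerimeter
        (grid (Fin.cons a (Fin.cons b m : Fin (n + 1) → ℕ) : Fin (n + 2) → ℕ)) := by
  obtain ⟨w, rfl⟩ : ∃ w, u = w + 1 := ⟨u - 1, by omega⟩
  rw [Nat.add_sub_cancel] at hvol
  refine ⟨stack w (grid (Fin.cons v m : Fin (n + 1) → ℕ)) B,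
    stack_subset_grid le_rfl (grid_cons_mono hvb m) hBv, ?_, ?_⟩
  · rw [card_stack, card_grid_cons, hBcard, ← hvol]
    ring
  · rw [directionalPerimeter_grid_cons_cons ha hb, ← hvol, ← hsum]
    have h1 := directionalPerimeter_stack_le (m := w) hBv
    have h2 := directionalPerimeter_grid_cons_le v m
    have h3 := directionalPerimeter_grid_cons_le c m
    rw [card_grid_cons] at h1
    -- With the box `c × m` on top the bound would equal the perimeter of the original box; `hBper`
    -- makes it strict.
    have h4 := Nat.mul_le_mul_left w h2
    nlinarith

/-! ### Arithmetic of the shortage `ℓ - a` -/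

/-- Here `s` and `t` are the floor and ceiling of `(b - a) / 2`, and `s * t` is the volume gained
per unit of cross-section. With `c = a + t - s * t`, the last inequality says `(ℓ - a)² ≤ 4(ℓ - c)`.
-/
theorem balanced_split {ℓ a b : ℕ} (hq : 2 ≤ ℓ - a) (hb : b = ℓ ∨ b = ℓ + 1) :
    ∃ s t, b = a + s + t ∧ (a + b) / 2 = a + s ∧ 1 ≤ s ∧ s ≤ t ∧ t ≤ s + 1 ∧
      (ℓ - a) ^ 2 + 4 * t ≤ 4 * (ℓ - a + s * t) := by
  obtain ⟨q, rfl⟩ : ∃ q, ℓ = a + q := ⟨ℓ - a, by omega⟩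
  rw [Nat.add_sub_cancel_left] at hq ⊢
  refine ⟨(b - a) / 2, b - a - (b - a) / 2, by omega, by omega, by omega, by omega, by omega, ?_⟩
  obtain ⟨t, ht⟩ := Nat.even_or_odd' q
  rcases hb with rfl | rfl <;> rcases ht with rfl | rfl
  · rw [show (a + 2 * t - a) / 2 = t by omega, show a + 2 * t - a - t = t by omega]
    nlinarith
  · rw [show (a + (2 * t + 1) - a) / 2 = t by omega,
      show a + (2 * t + 1) - a - t = t + 1 by omega]
    nlinarith
  · rw [show (a + 2 * t + 1 - a) / 2 = t by omega, show a + 2 * t + 1 - a - t = t + 1 by omega]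
    nlinarith
  · rw [show (a + (2 * t + 1) + 1 - a) / 2 = t + 1 by omega,
      show a + (2 * t + 1) + 1 - a - (t + 1) = t + 1 by omega]
    nlinarith

theorem two_le_of_pow_le {n q ℓ : ℕ} (hl : 1 ≤ ℓ)
    (h : 4 ^ (2 ^ (n + 1) - 1) * ℓ ≤ q ^ 2 ^ (n + 1)) : 2 ≤ q := by
  by_contra! hq
  have h1 : q ^ 2 ^ (n + 1) ≤ 1 := pow_le_one₀ (Nat.zero_le _) (by omega)
  have h2 : 2 ≤ 2 ^ (n + 1) := by
    have := Nat.one_le_two_pow (n := n)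
    rw [pow_succ]; omega
  have h3 : 4 ^ 1 ≤ 4 ^ (2 ^ (n + 1) - 1) := Nat.pow_le_pow_right (by norm_num) (by omega)
  nlinarith

/-- Replacing `q ^ 2` by `4 * r` halves the exponent of `q` and costs a factor `4 ^ 2 ^ (n + 1)`,
which is what the power of `4` provides. -/
theorem pow_le_pow_descend {n q r ℓ : ℕ} (hqr : q ^ 2 ≤ 4 * r)
    (h : 4 ^ (2 ^ (n + 2) - 1) * ℓ ≤ q ^ 2 ^ (n + 2)) :
    4 ^ (2 ^ (n + 1) - 1) * ℓ ≤ r ^ 2 ^ (n + 1) := by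
  have hpos : 0 < 4 ^ 2 ^ (n + 1) := by positivity
  refine Nat.le_of_mul_le_mul_left ?_ hpos
  have hone := Nat.one_le_two_pow (n := n + 1)
  calc 4 ^ 2 ^ (n + 1) * (4 ^ (2 ^ (n + 1) - 1) * ℓ)
      = 4 ^ (2 ^ (n + 2) - 1) * ℓ := by
        rw [← mul_assoc, ← pow_add]
        congr 2
        rw [pow_succ 2 (n + 1)]
        omega
    _ ≤ q ^ 2 ^ (n + 2) := h
    _ = (q ^ 2) ^ 2 ^ (n + 1) := by rw [← pow_mul, pow_succ' 2 (n + 1)]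
    _ ≤ (4 * r) ^ 2 ^ (n + 1) := Nat.pow_le_pow_left hqr _
    _ = 4 ^ 2 ^ (n + 1) * r ^ 2 ^ (n + 1) := mul_pow _ _ _

/-! ### Induction on the dimension -/

/-- A box with one short side and all others equal to `ℓ` or `ℓ + 1` can be improved: balance the
first two sides, then remove the excess volume from the top layer, which is again such a box with
one dimension fewer. -/
theorem exists_better_grid (n : ℕ) : ∀ (ℓ a b : ℕ) (m : Fin n → ℕ), 1 ≤ a → a ≤ ℓ →
    (b = ℓ ∨ b = ℓ + 1) → (∀ i, m i = ℓ ∨ m i = ℓ + 1) →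
    4 ^ (2 ^ (n + 1) - 1) * ℓ ≤ (ℓ - a) ^ 2 ^ (n + 1) →
    ∃ C ⊆ grid (Fin.cons ((a + b) / 2) (Fin.cons b m : Fin (n + 1) → ℕ) : Fin (n + 2) → ℕ),
      C.card = a * b * (grid m).card ∧
      directionalPerimeter C < directionalPerimeter
        (grid (Fin.cons a (Fin.cons b m : Fin (n + 1) → ℕ) : Fin (n + 2) → ℕ)) := by
  induction n with
  | zero =>
    intro ℓ a b m ha hal hb hm hq
    obtain ⟨s, t, hbs, hu, hs, hst, hts, hsq⟩ :=
      balanced_split (two_le_of_pow_le (ha.trans hal) hq) hb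
    norm_num at hq
    rw [hu]
    -- Here `hq` reads `4ℓ ≤ (ℓ - a)²`, so by `hsq` the excess fills a layer.
    have hlt : a + t ≤ s * t := by omega
    refine exists_better_of_mul_le (v := a + t) (fun i => i.elim0) ha (by omega) (by omega)
      (by omega) (by omega) ?_
    rw [hbs]
    linarith [show (a + s) * (a + t) = a * (a + s + t) + s * t by ring]
  | succ n ih =>
    intro ℓ a b m ha hal hb hm hq
    obtain ⟨s, t, hbs, hu, hs, hst, hts, hsq⟩ :=
      balanced_split (two_le_of_pow_le (ha.trans hal) hq) hb
    rw [hu]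
    have hprod : (a + s) * (a + t) = a * (a + s + t) + s * t := by ring
    by_cases hlt : a + t ≤ s * t
    · refine exists_better_of_mul_le (v := a + t) (fun i => ?_) ha (by omega) (by omega)
        (by omega) (by omega) ?_
      · rcases hm i with h | h <;> omega
      · rw [hbs]
        linarith
    · obtain ⟨b', m', rfl⟩ := exists_eq_cons m
      have hb' : b' = ℓ ∨ b' = ℓ + 1 := hm 0
      have hm' : ∀ i, m' i = ℓ ∨ m' i = ℓ + 1 := fun i => hm i.succ
      obtain ⟨c, hc⟩ : ∃ c, c + s * t = a + t := ⟨a + t - s * t, by omega⟩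
      have hts' : t ≤ s * t := Nat.le_mul_of_pos_left t hs
      obtain ⟨B, hBsub, hBcard, hBper⟩ := ih ℓ c b' m' (by omega) (by omega) hb' hm'
        (pow_le_pow_descend (by omega) hq)
      -- The improved layer must lie inside the layer below it; this is why the induction also
      -- bounds the first side of `C`. For `s = 1` the rounding down is needed.
      have hfit : (c + b') / 2 ≤ a + t := by
        by_cases hs1 : s = 1
        · subst hs1; omega
        · have : 2 * t ≤ s * t := Nat.mul_le_mul_right t (by omega)
          omega
      refine exists_better_of_top_layer (c := c) (v := a + t) ha (by omega) (by omega) (by omega)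
        (by omega) ?_ (hBsub.trans (grid_cons_mono hfit _)) ?_ hBper
      · obtain ⟨w, hw⟩ : ∃ w, a + s = w + 1 := ⟨a + s - 1, by omega⟩
        rw [hw] at hprod
        rw [hbs, hw, Nat.add_sub_cancel]
        linarith [add_one_mul w (a + t)]
      · rw [hBcard, card_grid_cons, mul_assoc]

/-! ### Return to the original statement -/

theorem box_eq_grid {n ℓ j q : ℕ} (hq : q ≤ ℓ) :
    box ℓ j (n + 1) q = grid (Fin.cons (ℓ - q)
      (fun i : Fin n => if i.val + 1 ≤ j then ℓ + 1 else ℓ) : Fin (n + 1) → ℕ) := by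
  unfold box grid
  congr 1
  funext i
  refine Fin.cases ?_ (fun i => ?_) i
  · simp [Nat.cast_sub hq]
  · by_cases h : i.val < j <;> simp [h]

/-- Raising to the power `2 ^ (d - 1)`, with `d = n + 2`, clears the real exponents. -/
theorem pow_le_of_scale_le {n ℓ q : ℕ}
    (h : (4 : ℝ) ^ cexp (n + 2) * scale ℓ (n + 2) ≤ (q : ℝ)) :
    4 ^ (2 ^ (n + 1) - 1) * ℓ ≤ q ^ 2 ^ (n + 1) := by
  have hexp : (2 : ℝ) ^ (1 - ((n + 2 : ℕ) : ℝ)) * ((2 ^ (n + 1) : ℕ) : ℝ) = 1 := by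
    push_cast
    rw [← Real.rpow_natCast 2 (n + 1), ← Real.rpow_add (by norm_num)]
    push_cast
    ring_nf
    simp
  have hone := Nat.one_le_two_pow (n := n + 1)
  have h1 : ((4 : ℝ) ^ cexp (n + 2)) ^ 2 ^ (n + 1) = 4 ^ (2 ^ (n + 1) - 1) := by
    rw [← Real.rpow_natCast _ (2 ^ (n + 1)), ← Real.rpow_mul (by norm_num), cexp, sub_mul, hexp,
      ← Real.rpow_natCast, Nat.cast_sub hone, one_mul, Nat.cast_one]
  have h2 : (scale ℓ (n + 2)) ^ 2 ^ (n + 1) = ℓ := by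
    rw [scale, ← Real.rpow_natCast _ (2 ^ (n + 1)), ← Real.rpow_mul (Nat.cast_nonneg _), hexp,
      Real.rpow_one]
  have h3 := pow_le_pow_left₀ (by unfold scale; positivity) h (2 ^ (n + 1))
  rw [mul_pow, h1, h2] at h3
  exact_mod_cast h3

theorem not_isMinimizer_of_directionalPerimeter_lt {d : ℕ} {C D : Finset (Fin d → ℤ)}
    (hC : C.Nonempty) (hcard : D.card = C.card)
    (hlt : directionalPerimeter D < directionalPerimeter C) : ¬ IsMinimizer C := by
  rintro (h | h)
  · exact hC.ne_empty h
  · have : minPerimeter d C.card ≤ edgePerimeter D := Nat.sInf_le ⟨D, hcard, rfl⟩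
    rw [← h, edgePerimeter_eq, edgePerimeter_eq] at this
    omega

end EIP

theorem lemma3p6 (d ℓ j p : ℕ) (hd : 2 ≤ d) (hj : j ≤ d - 1)
    (hne : 2 * p < ℓ)
    (hp : (4 : ℝ) ^ EIP.cexp d * EIP.scale ℓ d ≤ 2 * (p : ℝ)) :
    ¬ EIP.IsMinimizer (EIP.box ℓ j d (2 * p)) := by
  obtain ⟨n, rfl⟩ : ∃ n, d = n + 2 := ⟨d - 2, by omega⟩
  have hpow : 4 ^ (2 ^ (n + 1) - 1) * ℓ ≤ (ℓ - (ℓ - 2 * p)) ^ 2 ^ (n + 1) := by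
    rw [Nat.sub_sub_self hne.le]
    exact EIP.pow_le_of_scale_le (by exact_mod_cast hp)
  rw [EIP.box_eq_grid hne.le]
  obtain ⟨M, hM⟩ : ∃ M : Fin (n + 1) → ℕ,
      M = fun i : Fin (n + 1) => if i.val + 1 ≤ j then ℓ + 1 else ℓ := ⟨_, rfl⟩
  have hside : ∀ i, M i = ℓ ∨ M i = ℓ + 1 := by
    intro i
    rw [hM]
    dsimp only
    split_ifs <;> simp
  rw [← hM]
  clear hM
  obtain ⟨b, m, rfl⟩ := EIP.exists_eq_cons M
  have hb : b = ℓ ∨ b = ℓ + 1 := hside 0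
  have hm : ∀ i, m i = ℓ ∨ m i = ℓ + 1 := fun i => hside i.succ
  obtain ⟨C, -, hCcard, hCper⟩ :=
    EIP.exists_better_grid n ℓ (ℓ - 2 * p) b m (by omega) (by omega) hb hm hpow
  refine EIP.not_isMinimizer_of_directionalPerimeter_lt ?_ ?_ hCper
  · refine Finset.card_pos.1 (EIP.card_grid_pos fun i => ?_)
    refine Fin.cases ?_ (fun i => ?_) i
    · rw [Fin.cons_zero]; omega
    · rw [Fin.cons_succ]
      rcases hside i with h | h <;> omega
  · rw [hCcard, EIP.card_grid_cons, EIP.card_grid_cons, mul_assoc]
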